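/- **Setting.** Time is discrete. Let $\tau_1,\dots,\tau_n$ be mixed-criticality sporadic tasks, listed by decreasing priority, to be run on $m\ge 1$ identical processors. Task $\tau_i$ has a minimum inter-arrival time $T_i$, a relative deadline $D_i$ with $1\le D_i\le T_i$, a criticality $L_i\ge 1$, and worst-case execution times $C_i(\ell)\ge 1$ ($\ell\ge 1$) with $C_i(\ell)\le C_i(\ell+1)$ for $1\le \ell<L_i$ and $C_i(\ell)=C_i(L_i)$ for $\ell\ge L_i$. It releases finitely or infinitely many jobs $J_{i,k}$ at integer times $r_{i,k}$ with $r_{i,k+1}\ge r_{i,k}+T_i$; the exact execution time $c_{i,k}$ of $J_{i,k}$ satisfies $1\le c_{i,k}\le C_i(L_i)$. **Scheduler (MSM).** The criticality level of the system at time $t$ is the least $\ell\ge1$ such that no job has overrun its level-$\ell$ estimate by time $t$; a job of $\tau_j$ overruns $C_j(\ell)$ as soon as it has executed for $C_j(\ell)$ time units without being complete. A job of $\tau_j$ is available at time $t$ if it is released, not complete, and the criticality level at time $t$ is at most $L_j$ (otherwise $\tau_j$ is suspended and its jobs are dropped). In every unit time slot the $m$ available jobs of highest priority are executed, each on one processor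 (all available jobs, if there are at most $m$); ties between jobs of one task are broken arbitrarily. **Response-time bound.** For $T,C\geq 1$ and integers $x,D\ge 0$ with $D\ge C$ put $W^{NC}(x)=\lfloor x/T\rfloor C+\min(C,\,x \bmod T)$ and $W^{CI}(x)=W^{NC}(x+D-C)$. With the parameters $T_j,D_j,C_j(\ell)$ of $\tau_j$ inserted, giving $W_j^{NC}$ and $W_j^{CI}$, let, for $j<i$, $$I^{NC}_{j,i}(x,\ell)=\min\big(W_j^{NC}(x),\,x-C_i(\ell)+1\big),\qquad I^{CI}_{j,i}(x,\ell)=\min\big(W_j^{CI}(x),\,x-C_i(\ell)+1\big),$$ $I^{DIFF}_{j,i}=I^{CI}_{j,i}-I^{NC}_{j,i}$, and let $I_i(x,\ell)$ be $\sum_{j<i}I^{NC}_{j,i}(x,\ell)$ plus the sum of the $m-1$ largest of the numbers $I^{DIFF}_{j,i}(x,\ell)$, $j<i$ (of all of them, if there are fewer than $m-1$). Let $R_i(\ell)$ be the least integer $x\ge C_i(\ell)$ with $$x=C_i(\ell)+\left\lfloor \frac{I_i(x,\ell)}{m}\right\rfloor ,$$ and $R_i(\ell)=\infty$ if there is none.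 **Theorem.** Let $1\le \ell\le L_i$, write $\ell_j=\min(\ell,L_j)$, and suppose that the response-time test succeeds at these levels for $\tau_i$ and the tasks of higher priority: $R_j(\ell_j)\le D_j$ for all $j\le i$. Consider any job sequence and any MSM schedule of it in which, for every higher-priority task $\tau_j$ ($j<i$), every job $J_{j,p}$ is complete at every time $t\ge r_{j,p}+R_j(\ell_j)$ at which the criticality level of the system is at most $\ell_j$. Then every job $J_{i,k}$ of $\tau_i$ is complete at every time $t\ge r_{i,k}+R_i(\ell)$ at which the criticality level of the system is at most $\ell$. In particular, in a scenario of criticality level at most $\ell$ (one in which $c_{j,p}\le C_j(\ell)$ for all jobs), if all jobs of all higher-priority tasks complete within $R_j(\ell_j)$ of their release, or are dropped before that, then all jobs of $\tau_i$ complete within $R_i(\ell)$ of their release. -/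

import Mathlib

/-- A mixed-criticality sporadic task: minimum inter-arrival time `T`, constrained relative
deadline `D`, criticality `L`, and worst-case execution time estimate `C v` at each criticality
level `v ≥ 1` (the value `C 0` is never used). The estimate is constant from level `L` on, so a
global bound on the criticality levels need not be carried along. -/
structure MCTask where
  T : ℕ
  D : ℕ
  L : ℕ
  C : ℕ → ℕ
  deadline_pos : 1 ≤ D
  deadline_le_period : D ≤ T
  crit_pos : 1 ≤ L
  wcet_pos : ∀ v, 1 ≤ v → 1 ≤ C v
  wcet_mono : ∀ v, 1 ≤ v → v < L → C v ≤ C (v + 1)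
  wcet_const : ∀ v, L ≤ v → C v = C L

namespace MCTask

variable {n : ℕ}

/-! ### The offline response-time bound

Tasks are indexed by `Fin n`, and a smaller index means a higher priority, so the set of tasks
of higher priority than `i` is `Finset.Iio i`. -/

/-- Largest workload, within a window of length `x`, of a task with period `T` and execution
time `C` all of whose jobs executing in the window are released inside it. -/
def workloadNC (T C x : ℕ) : ℕ := x / T * C + min C (x % T)

/-- Largest workload, within a window of length `x`, of a task that may carry in a job, when
every job is finished at most `D` time units after its release. -/
def workloadCI (T D C x : ℕ) : ℕ := workloadNC T C (x + D - C)

/-- Non-carry-in interfering workload bound of task `j` on task `i`, window `x`, level `ℓ`. -/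
def intNC (τ : Fin n → MCTask) (j i : Fin n) (x ℓ : ℕ) : ℕ :=
  min (workloadNC (τ j).T ((τ j).C ℓ) x) (x + 1 - (τ i).C ℓ)

/-- Carry-in interfering workload bound of task `j` on task `i`, window `x`, level `ℓ`. -/
def intCI (τ : Fin n → MCTask) (j i : Fin n) (x ℓ : ℕ) : ℕ :=
  min (workloadCI (τ j).T (τ j).D ((τ j).C ℓ) x) (x + 1 - (τ i).C ℓ)

/-- Difference of the carry-in and the non-carry-in bound. -/
def intDiff (τ : Fin n → MCTask) (j i : Fin n) (x ℓ : ℕ) : ℕ :=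
  intCI τ j i x ℓ - intNC τ j i x ℓ

/-- Total interfering workload bound: the non-carry-in bounds of all higher-priority tasks plus
the sum of the `m - 1` largest differences, written as the largest sum of differences over the
sets of at most `m - 1` higher-priority tasks. -/
def totalInt (τ : Fin n → MCTask) (m : ℕ) (i : Fin n) (x ℓ : ℕ) : ℕ :=
  ∑ j ∈ Finset.Iio i, intNC τ j i x ℓ +
    ((Finset.Iio i).powerset.filter fun S => S.card ≤ m - 1).sup
      fun S => ∑ j ∈ S, intDiff τ j i x ℓ

/-- The response-time bound of task `i` at level `ℓ`: the least `x` with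
`x = C_i(ℓ) + ⌊totalInt(x, ℓ) / m⌋`, and `⊤` if there is no such `x`. -/
noncomputable def responseTime (τ : Fin n → MCTask) (m : ℕ) (i : Fin n) (ℓ : ℕ) : ℕ∞ :=
  ⨅ x ∈ {x : ℕ | x = (τ i).C ℓ + totalInt τ m i x ℓ / m}, (x : ℕ∞)

/-! ### Run-time behaviour -/

/-- The jobs generated by a task set: task `i` releases the jobs `(i, k)` with `k < count i`
(finitely or infinitely many), at time `release i k` and with exact execution time `cost i k`. -/
structure JobSequence (τ : Fin n → MCTask) where
  count : Fin n → ℕ∞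
  release : Fin n → ℕ → ℕ
  cost : Fin n → ℕ → ℕ
  sporadic : ∀ i, ∀ k : ℕ, ((k + 1 : ℕ) : ℕ∞) < count i → release i k + (τ i).T ≤ release i (k + 1)
  cost_pos : ∀ i, ∀ k : ℕ, (k : ℕ∞) < count i → 1 ≤ cost i k
  cost_le : ∀ i, ∀ k : ℕ, (k : ℕ∞) < count i → cost i k ≤ (τ i).C (τ i).L

/-- A schedule assigns to each time slot `[t, t + 1)` the finite set of the jobs executing in it,
each of them on one processor. -/
abbrev Schedule (n : ℕ) := ℕ → Finset (Fin n × ℕ)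

/-- Processor time received by job `(i, k)` in `[0, t)`. -/
def service (σ : Schedule n) (i : Fin n) (k t : ℕ) : ℕ :=
  ((Finset.range t).filter fun s => (i, k) ∈ σ s).card

/-- The criticality level of the system at time `t`: the least level `v ≥ 1` such that no job has
overrun its execution time estimate of level `v` by time `t`. A job overruns it as soon as it has
received `C v` units of processor time without being complete; the condition `service ≤ C v`
keeps track of the jobs that overran it and have completed since. -/
noncomputable def critLevel {τ : Fin n → MCTask} (J : JobSequence τ) (σ : Schedule n) (t : ℕ) :
    ℕ :=
  sInf {v | 1 ≤ v ∧ ∀ i, ∀ k : ℕ, (k : ℕ∞) < J.count i →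
    ¬ ((τ i).C v ≤ service σ i k t ∧ service σ i k t < J.cost i k) ∧
      service σ i k t ≤ (τ i).C v}

/-- Job `(i, k)` is complete at time `t`. -/
def Completed {τ : Fin n → MCTask} (J : JobSequence τ) (σ : Schedule n) (i : Fin n) (k t : ℕ) :
    Prop :=
  J.cost i k ≤ service σ i k t

/-- Job `(i, k)` can be dispatched at time `t`: it is released, it is not complete, and its task
has not been suspended, i.e. the criticality level of the system is at most that of the task. -/
def Available {τ : Fin n → MCTask} (J : JobSequence τ) (σ : Schedule n) (i : Fin n) (k t : ℕ) :
    Prop :=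
  (k : ℕ∞) < J.count i ∧ J.release i k ≤ t ∧ ¬ Completed J σ i k t ∧
    critLevel J σ t ≤ (τ i).L

/-- `σ` is a schedule of the jobs `J` by global preemptive work-conserving fixed-priority
scheduling on `m` processors, with execution monitoring and task suspension: in each slot the `m`
available jobs of highest priority are executed (all of them, if there are at most `m`); ties
between jobs of one task are broken arbitrarily. -/
structure IsMSM {τ : Fin n → MCTask} (m : ℕ) (J : JobSequence τ) (σ : Schedule n) : Prop where
  available : ∀ t i k, (i, k) ∈ σ t → Available J σ i k t
  card_le : ∀ t, (σ t).card ≤ m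
  greedy : ∀ t i k, Available J σ i k t → (i, k) ∉ σ t →
    (σ t).card = m ∧ ∀ p ∈ σ t, p.1 ≤ i

/-- As long as the criticality level of the system is at most `v`, every job of task `i` is
complete `R` time units after its release. -/
def CompletesWithin {τ : Fin n → MCTask} (J : JobSequence τ) (σ : Schedule n) (v : ℕ)
    (i : Fin n) (R : ℕ∞) : Prop :=
  ∀ k t : ℕ, (k : ℕ∞) < J.count i → (J.release i k : ℕ∞) + R ≤ (t : ℕ∞) →
    critLevel J σ t ≤ v → Completed J σ i k t

end MCTask

/-! Suppose a job of `τ i`, released at `r`, is incomplete at some `t ≥ r + x`, where `x` is the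
response-time bound and the level is still at most `ℓ`. Move back from `r` to the least `a` such
that all slots of `[a, r)` are fully busy with higher-priority jobs, and study the window `[a, a +
x)`, which ends no later than `t`. A slot of it in which the job does not execute is fully busy:
before `r` by the choice of `a`, afterwards because the job is available and has no rival from its
own task. No overrun at level `ℓ` leaves at least `x + 1 - C` such slots, `C` being the job's
estimate at level `ℓ`.

In exactly `x + 1 - C` of them the higher-priority tasks do `m * (x + 1 - C)` units of work. Each
task does at most one unit per slot and at most its workload bound, and at most `m - 1` tasks carry
work into the window (`IsMSM.exists_busy_start`). Hence this work is at most `totalInt`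
(`IsMSM.card_mul_le_totalInt`), so the floor in the fixed-point equation is at least `x + 1 - C`, a
contradiction. Minimality of the fixed point plays no role in this. -/

namespace MCTask

/-! ### The workload bound -/

section Workload

variable {T C : ℕ}

theorem workloadNC_add_period (hT : 0 < T) (x : ℕ) :
    workloadNC T C (x + T) = workloadNC T C x + C := by
  simp only [workloadNC, Nat.add_div_right _ hT, Nat.add_mod_right, Nat.succ_mul]
  omega

theorem workloadNC_of_lt {x : ℕ} (hx : x < T) : workloadNC T C x = min C x := by
  simp [workloadNC, Nat.div_eq_of_lt hx, Nat.mod_eq_of_lt hx]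

/-- The graph has slopes 0 and 1 within a period, and `C ≤ T` excludes a larger jump at its end. -/
theorem workloadNC_succ (hT : 0 < T) (hC : C ≤ T) (x : ℕ) :
    workloadNC T C x ≤ workloadNC T C (x + 1) ∧
      workloadNC T C (x + 1) ≤ workloadNC T C x + 1 := by
  induction x using Nat.strong_induction_on with
  | _ x ih =>
    rcases Nat.lt_or_ge x T with hx | hx
    · rcases Nat.lt_or_ge (x + 1) T with hx' | hx'
      · rw [workloadNC_of_lt hx, workloadNC_of_lt hx']
        omega
      · have hxT : x + 1 = 0 + T := by omega
        rw [hxT, workloadNC_add_period hT, workloadNC_of_lt hx, workloadNC_of_lt hT]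
        omega
    · obtain ⟨y, rfl⟩ := Nat.exists_eq_add_of_le' hx
      have := ih y (by omega)
      rw [Nat.add_right_comm, workloadNC_add_period hT, workloadNC_add_period hT]
      omega

theorem workloadNC_mono (hT : 0 < T) (hC : C ≤ T) : Monotone (workloadNC T C) :=
  monotone_nat_of_le_succ fun x => (workloadNC_succ hT hC x).1

theorem workloadNC_add_le (hT : 0 < T) (hC : C ≤ T) (x d : ℕ) :
    workloadNC T C (x + d) ≤ workloadNC T C x + d := by
  induction d with
  | zero => simp
  | succ d ih => have := (workloadNC_succ hT hC (x + d)).2; rw [← Nat.add_assoc]; omega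

theorem workloadNC_zero (hT : 0 < T) : workloadNC T C 0 = 0 := by
  simp [workloadNC_of_lt hT]

/-- Peels off the first job of a window, which does `e` units of work; the next is released at least
`T` later. -/
theorem add_workloadNC_sub_le (hT : 0 < T) {e x : ℕ} (heC : e ≤ C) (hex : e ≤ x) :
    e + workloadNC T C (x - T) ≤ workloadNC T C x := by
  rcases Nat.lt_or_ge x T with hx | hx
  · rw [Nat.sub_eq_zero_of_le hx.le, workloadNC_zero hT, workloadNC_of_lt hx]
    omega
  · obtain ⟨y, rfl⟩ := Nat.exists_eq_add_of_le' hx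
    rw [workloadNC_add_period hT, Nat.add_sub_cancel]
    omega

theorem workloadNC_le_workloadCI (hT : 0 < T) {D : ℕ} (hCD : C ≤ D) (hDT : D ≤ T) (x : ℕ) :
    workloadNC T C x ≤ workloadCI T D C x :=
  workloadNC_mono hT (hCD.trans hDT) (by omega)

/-- Here `e` is the work of the carried-in job and `g` the offset of the next possible release. If
`e` falls short of `C`, that release may come `C - e` earlier, which by the Lipschitz bound gains at
most the `C - e` units lost. -/
theorem add_workloadNC_le_workloadCI (hT : 0 < T) {D : ℕ} (hCD : C ≤ D) (hDT : D ≤ T)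
    {e g x : ℕ} (heC : e ≤ C) (hex : e ≤ x) (hg : e + T ≤ g + D) :
    e + workloadNC T C (x - g) ≤ workloadCI T D C x := by
  have hCT := hCD.trans hDT
  have h₁ : workloadNC T C (x - g) ≤ workloadNC T C (x + D - C - T + (C - e)) :=
    workloadNC_mono hT hCT (by omega)
  rcases Nat.lt_or_ge (x + D - C) T with hy | hy
  · have h₂ := workloadNC_add_le hT hCT 0 (x - g)
    simp only [workloadNC_zero hT, Nat.zero_add] at h₂
    rw [workloadCI, workloadNC_of_lt hy]
    omega
  · have h₂ := workloadNC_add_le hT hCT (x + D - C - T) (C - e)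
    have h₃ := workloadNC_add_period (C := C) hT (x + D - C - T)
    rw [Nat.sub_add_cancel hy] at h₃
    rw [workloadCI, h₃]
    omega

end Workload

/-! ### The work of one task in a window

`E k s` says that the `k`-th job of the task, released at time `r k`, executes in slot `s`. -/

section Window

open scoped Classical in
/-- The slots of the window `[a, b)` in which some job executes. -/
noncomputable def busySlots (E : ℕ → ℕ → Prop) (a b : ℕ) : Finset ℕ :=
  (Finset.Ico a b).filter fun s => ∃ k, E k s

variable {E : ℕ → ℕ → Prop} {r : ℕ → ℕ} {T D C a b : ℕ}

theorem mem_busySlots {s : ℕ} : s ∈ busySlots E a b ↔ (a ≤ s ∧ s < b) ∧ ∃ k, E k s := by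
  simp [busySlots]

theorem card_busySlots_le : (busySlots E a b).card ≤ b - a := by
  classical
  simpa [busySlots] using Finset.card_filter_le (Finset.Ico a b) fun s => ∃ k, E k s

/-- The work of the first job executing in a window and of the later ones. -/
theorem card_busySlots_le_add
    (hE : ∀ k s, s < b → E k s → r k ≤ s ∧ s < r k + D) (hDT : D ≤ T)
    (hr : ∀ k l s s', s < b → s' < b → E k s → E l s' → k < l → r k + T ≤ r l)
    (hC : ∀ k, (busySlots (fun _ => E k) 0 b).card ≤ C)
    (hne : (busySlots E a b).Nonempty) :
    ∃ k s e, (a ≤ s ∧ s < b) ∧ E k s ∧ e ≤ C ∧ e ≤ b - a ∧ e ≤ r k + D - a ∧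
      (busySlots E a b).card ≤ e + (busySlots E (r k + T) b).card ∧
      ∀ l s', r k + T ≤ s' → s' < b → a ≤ s' → E l s' → r k + T ≤ r l := by
  classical
  have hex : ∃ k s, (a ≤ s ∧ s < b) ∧ E k s := by
    obtain ⟨s, hs⟩ := hne
    obtain ⟨h, k, hk⟩ := mem_busySlots.1 hs
    exact ⟨k, s, h, hk⟩
  -- The least index executing in the window is the earliest released, so every other job there is
  -- released at least `T` after it.
  obtain ⟨s, hs, hks⟩ := Nat.find_spec hex
  have hmin : ∀ l s', (a ≤ s' ∧ s' < b) → E l s' → Nat.find hex ≤ l :=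
    fun l s' h h' => Nat.find_min' hex ⟨s', h, h'⟩
  generalize Nat.find hex = k at hks hmin
  have hlater : ∀ l s', (a ≤ s' ∧ s' < b) → E l s' → l ≠ k → r k + T ≤ r l :=
    fun l s' h h' hl => hr k l s s' hs.2 h.2 hks h' (lt_of_le_of_ne (hmin l s' h h') hl.symm)
  refine ⟨k, s, (busySlots (fun _ => E k) a b).card, hs, hks, ?_, card_busySlots_le, ?_, ?_, ?_⟩
  · refine (Finset.card_le_card fun s' hs' => ?_).trans (hC k)
    rw [mem_busySlots] at hs' ⊢
    exact ⟨⟨Nat.zero_le _, hs'.1.2⟩, hs'.2⟩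
  · refine (Finset.card_le_card fun s' hs' => ?_).trans (Nat.card_Ico a (r k + D)).le
    obtain ⟨h, _, hk⟩ := mem_busySlots.1 hs'
    exact Finset.mem_Ico.2 ⟨h.1, (hE k s' h.2 hk).2⟩
  · refine (Finset.card_le_card fun s' hs' => ?_).trans (Finset.card_union_le _ _)
    obtain ⟨h, l, hl⟩ := mem_busySlots.1 hs'
    rw [Finset.mem_union, mem_busySlots, mem_busySlots]
    by_cases hlk : l = k
    · exact Or.inl ⟨h, 0, hlk ▸ hl⟩
    · exact Or.inr ⟨⟨(hlater l s' h hl hlk).trans (hE l s' h.2 hl).1, h.2⟩, l, hl⟩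
  · intro l s' h h' ha hl
    refine hlater l s' ⟨ha, h'⟩ hl ?_
    rintro rfl
    have := (hE l s' h' hl).2
    omega

/-- The work of a task in a window in which no job executes that was released before it. -/
theorem card_busySlots_le_workloadNC (hT : 0 < T)
    (hE : ∀ k s, s < b → E k s → r k ≤ s ∧ s < r k + D) (hDT : D ≤ T) (hCT : C ≤ T)
    (hr : ∀ k l s s', s < b → s' < b → E k s → E l s' → k < l → r k + T ≤ r l)
    (hC : ∀ k, (busySlots (fun _ => E k) 0 b).card ≤ C) (a : ℕ)
    (ha : ∀ k s, a ≤ s → s < b → E k s → a ≤ r k) :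
    (busySlots E a b).card ≤ workloadNC T C (b - a) := by
  induction hx : b - a using Nat.strong_induction_on generalizing a with
  | _ x ih =>
    subst hx
    rcases (busySlots E a b).eq_empty_or_nonempty with h | hne
    · simp [h]
    obtain ⟨k, s, e, hs, hks, heC, hex, -, hcard, hlater⟩ :=
      card_busySlots_le_add hE hDT hr hC hne
    have hak := ha k s hs.1 hs.2 hks
    have hrest := ih _ (by omega) (r k + T)
      (fun l s' h h' hl => hlater l s' h h' (by omega) hl) rfl
    have hmono : workloadNC T C (b - (r k + T)) ≤ workloadNC T C (b - a - T) :=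
      workloadNC_mono hT hCT (by omega)
    have := add_workloadNC_sub_le hT heC hex
    omega

/-- The work of a task in an arbitrary window. -/
theorem card_busySlots_le_workloadCI (hT : 0 < T)
    (hE : ∀ k s, s < b → E k s → r k ≤ s ∧ s < r k + D) (hDT : D ≤ T) (hCD : C ≤ D)
    (hr : ∀ k l s s', s < b → s' < b → E k s → E l s' → k < l → r k + T ≤ r l)
    (hC : ∀ k, (busySlots (fun _ => E k) 0 b).card ≤ C) (a : ℕ) :
    (busySlots E a b).card ≤ workloadCI T D C (b - a) := by
  have hCT := hCD.trans hDT
  rcases (busySlots E a b).eq_empty_or_nonempty with h | hne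
  · simp [h]
  obtain ⟨k, s, e, hs, hks, heC, hex, heD, hcard, hlater⟩ :=
    card_busySlots_le_add hE hDT hr hC hne
  have hsk := hE k s hs.2 hks
  have hrest := card_busySlots_le_workloadNC hT hE hDT hCT hr hC (r k + T)
    (fun l s' h h' hl => hlater l s' h h' (by omega) hl)
  rcases Nat.lt_or_ge (r k) a with hka | hka
  · have := add_workloadNC_le_workloadCI hT hCD hDT heC hex
      (show e + T ≤ (r k + T - a) + D by omega)
    rw [show b - a - (r k + T - a) = b - (r k + T) by omega] at this
    omega
  · have hmono : workloadNC T C (b - (r k + T)) ≤ workloadNC T C (b - a - T) :=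
      workloadNC_mono hT hCT (by omega)
    have := add_workloadNC_sub_le hT heC hex
    have := workloadNC_le_workloadCI hT hCD hDT (b - a)
    omega

end Window

variable {n : ℕ} {τ : Fin n → MCTask}

/-! ### Properties of tasks and of the response-time bound -/

theorem period_pos (M : MCTask) : 0 < M.T :=
  M.deadline_pos.trans M.deadline_le_period

theorem wcet_le (M : MCTask) {v w : ℕ} (hv : 1 ≤ v) (hvw : v ≤ w) : M.C v ≤ M.C w := by
  induction w, hvw using Nat.le_induction with
  | base => exact le_rfl
  | succ w hw ih =>
    refine ih.trans ?_
    rcases Nat.lt_or_ge w M.L with h | h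
    · exact M.wcet_mono w (hv.trans hw) h
    · rw [M.wcet_const w h, M.wcet_const (w + 1) (by omega)]

/-- Reconciles the capped level at which a task is tested with the level at which its interference
is counted. -/
theorem wcet_min (M : MCTask) (v : ℕ) : M.C (min v M.L) = M.C v := by
  rcases le_total v M.L with h | h
  · rw [min_eq_left h]
  · rw [min_eq_right h, M.wcet_const v h]

theorem exists_eq_responseTime {m : ℕ} {i : Fin n} {v d : ℕ} (h : responseTime τ m i v ≤ d) :
    ∃ x : ℕ, x = (τ i).C v + totalInt τ m i x v / m ∧ responseTime τ m i v = x := by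
  classical
  have hex : ∃ x : ℕ, x = (τ i).C v + totalInt τ m i x v / m := by
    by_contra! hne
    have : responseTime τ m i v = ⊤ := by
      simp only [responseTime, Set.mem_ofPred_eq, iInf_eq_top]
      exact fun x hx => absurd hx (hne x)
    simp [this] at h
  refine ⟨Nat.find hex, Nat.find_spec hex, le_antisymm ?_ ?_⟩
  · exact iInf₂_le (Nat.find hex) (Nat.find_spec hex)
  · exact le_iInf₂ fun x hx => Nat.cast_le.2 (Nat.find_min' hex hx)

theorem wcet_le_deadline_of_responseTime_le {m : ℕ} {j : Fin n} {v : ℕ}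
    (h : responseTime τ m j (min v (τ j).L) ≤ (τ j).D) : (τ j).C v ≤ (τ j).D := by
  obtain ⟨x, hx, hx'⟩ := exists_eq_responseTime h
  rw [hx', Nat.cast_le] at h
  rw [wcet_min] at hx
  exact (hx ▸ Nat.le_add_right _ _ : (τ j).C v ≤ x).trans h

theorem le_totalInt {m : ℕ} (i : Fin n) (x v : ℕ) {w : Fin n → ℕ} {S : Finset (Fin n)}
    (hS : S ⊆ Finset.Iio i) (hcard : S.card ≤ m - 1)
    (hNC : ∀ j < i, j ∉ S → w j ≤ intNC τ j i x v) (hCI : ∀ j ∈ S, w j ≤ intCI τ j i x v) :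
    ∑ j ∈ Finset.Iio i, w j ≤ totalInt τ m i x v := by
  -- Truncation in `intDiff` is harmless: it can only enlarge the right-hand side.
  have h₁ : ∀ j ∈ Finset.Iio i,
      w j ≤ intNC τ j i x v + if j ∈ S then intDiff τ j i x v else 0 := by
    intro j hj
    split_ifs with h
    · have := hCI j h
      rw [intDiff]
      omega
    · exact hNC j (Finset.mem_Iio.1 hj) h
  refine (Finset.sum_le_sum h₁).trans ?_
  rw [Finset.sum_add_distrib, Finset.sum_ite_mem, Finset.inter_eq_right.2 hS, totalInt]
  refine Nat.add_le_add_left ?_ _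
  exact Finset.le_sup (f := fun S => ∑ j ∈ S, intDiff τ j i x v)
    (Finset.mem_filter.2 ⟨Finset.mem_powerset.2 hS, hcard⟩)

/-! ### Properties of schedules -/

variable {J : JobSequence τ} {σ : Schedule n} {m : ℕ}

theorem service_mono (σ : Schedule n) (i : Fin n) (k : ℕ) : Monotone (service σ i k) :=
  fun _ _ h => Finset.card_le_card
    (Finset.filter_subset_filter _ (Finset.range_subset_range.2 h))

theorem JobSequence.release_add_le (J : JobSequence τ) (i : Fin n) {k l : ℕ} (hkl : k < l)
    (hl : (l : ℕ∞) < J.count i) : J.release i k + (τ i).T ≤ J.release i l := by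
  induction l, hkl using Nat.le_induction with
  | base => exact J.sporadic i k hl
  | succ l hkl ih =>
    have := ih (lt_of_le_of_lt (Nat.cast_le.2 l.le_succ) hl)
    have := J.sporadic i l hl
    omega

theorem IsMSM.service_le_cost (hσ : IsMSM m J σ) (i : Fin n) (k t : ℕ) :
    service σ i k t ≤ J.cost i k := by
  induction t with
  | zero => simp [service]
  | succ t ih =>
    by_cases h : (i, k) ∈ σ t
    · have := (hσ.available t i k h).2.2.1
      rw [service, Finset.range_add_one, Finset.filter_insert, if_pos h,
        Finset.card_insert_of_notMem (by simp)]
      simpa [Completed, service] using this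
    · rwa [service, Finset.range_add_one, Finset.filter_insert, if_neg h]

/-- No job has overrun its execution time estimate of level `v` by time `t`. -/
def NoOverrun (J : JobSequence τ) (σ : Schedule n) (v t : ℕ) : Prop :=
  ∀ i, ∀ k : ℕ, (k : ℕ∞) < J.count i →
    ¬ ((τ i).C v ≤ service σ i k t ∧ service σ i k t < J.cost i k) ∧
      service σ i k t ≤ (τ i).C v

theorem NoOverrun.level_mono {v w t : ℕ} (hv : 1 ≤ v) (hvw : v ≤ w) (h : NoOverrun J σ v t) :
    NoOverrun J σ w t := by
  intro i k hk
  have := h i k hk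
  have := (τ i).wcet_le hv hvw
  omega

/-- A job that overran by `s` but has completed by `t` has by then received more than `C v`, which
the second clause forbids. -/
theorem NoOverrun.time_anti {v s t : ℕ} (hst : s ≤ t) (h : NoOverrun J σ v t) :
    NoOverrun J σ v s := by
  intro i k hk
  have := h i k hk
  have := service_mono σ i k hst
  omega

theorem IsMSM.exists_noOverrun (hσ : IsMSM m J σ) (t : ℕ) : ∃ v, 1 ≤ v ∧ NoOverrun J σ v t := by
  -- A level above every `L`, where each estimate is the final one and bounds the exact cost.
  refine ⟨1 + ∑ i, (τ i).L, by omega, fun i k hk => ?_⟩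
  have hL : (τ i).L ≤ ∑ i, (τ i).L :=
    Finset.single_le_sum (f := fun i => (τ i).L) (fun _ _ => Nat.zero_le _) (Finset.mem_univ i)
  have h₁ := (τ i).wcet_const (1 + ∑ i, (τ i).L) (by omega)
  have h₂ := J.cost_le i k hk
  have h₃ := hσ.service_le_cost i k t
  omega

theorem IsMSM.critLevel_le_iff (hσ : IsMSM m J σ) {v t : ℕ} (hv : 1 ≤ v) :
    critLevel J σ t ≤ v ↔ NoOverrun J σ v t := by
  constructor
  · intro h
    have hmem : critLevel J σ t ∈ {v | 1 ≤ v ∧ NoOverrun J σ v t} :=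
      Nat.sInf_mem (hσ.exists_noOverrun t)
    exact hmem.2.level_mono hmem.1 h
  · exact fun h => Nat.sInf_le ⟨hv, h⟩

theorem IsMSM.critLevel_mono (hσ : IsMSM m J σ) : Monotone (critLevel J σ) := by
  intro s t hst
  have hmem : critLevel J σ t ∈ {v | 1 ≤ v ∧ NoOverrun J σ v t} :=
    Nat.sInf_mem (hσ.exists_noOverrun t)
  exact (hσ.critLevel_le_iff hmem.1).2 (hmem.2.time_anti hst)

theorem Completed.mono {i : Fin n} {k s t : ℕ} (h : Completed J σ i k s) (hst : s ≤ t) :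
    Completed J σ i k t :=
  le_trans h (service_mono σ i k hst)

theorem IsMSM.available_of_mem_later (hσ : IsMSM m J σ) {j : Fin n} {k s t : ℕ}
    (h : (j, k) ∈ σ t) (hst : s ≤ t) (hr : J.release j k ≤ s) : Available J σ j k s := by
  obtain ⟨h₁, -, h₃, h₄⟩ := hσ.available t j k h
  exact ⟨h₁, hr, fun hc => h₃ (hc.mono hst), (hσ.critLevel_mono hst).trans h₄⟩

/-- A job executes only before the time within which its task completes. -/
theorem IsMSM.lt_release_add (hσ : IsMSM m J σ) {j : Fin n} {k s v d : ℕ} {R : ℕ∞}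
    (hR : CompletesWithin J σ (min v (τ j).L) j R) (hRd : R ≤ d)
    (hv : critLevel J σ s ≤ v) (h : (j, k) ∈ σ s) : s < J.release j k + d := by
  obtain ⟨h₁, -, h₃, h₄⟩ := hσ.available s j k h
  by_contra! hs
  refine h₃ (hR k s h₁ ?_ (le_min hv h₄))
  calc (J.release j k : ℕ∞) + R ≤ J.release j k + d := by gcongr
    _ ≤ s := by exact_mod_cast hs

/-! ### Fully busy slots and the interference in the extended window. -/

/-- Slots in which `m` jobs of tasks of higher priority than `i` execute. -/
def FullyBusy (m : ℕ) (σ : Schedule n) (i : Fin n) (s : ℕ) : Prop :=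
  (σ s).card = m ∧ ∀ p ∈ σ s, p.1 < i

/-- A maximal interval of fully busy slots ending at `r` starts at a time with at most `m - 1`
tasks of higher priority with pending jobs. -/
theorem IsMSM.exists_busy_start (hσ : IsMSM m J σ) (i : Fin n) (r : ℕ) :
    ∃ a ≤ r, (∀ s, a ≤ s → s < r → FullyBusy m σ i s) ∧
      ∃ S ⊆ Finset.Iio i, S.card ≤ m - 1 ∧ ∀ j < i, ∀ k s, a ≤ s → (j, k) ∈ σ s →
        J.release j k < a → j ∈ S := by
  classical
  have hex : ∃ a, a ≤ r ∧ ∀ s, a ≤ s → s < r → FullyBusy m σ i s :=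
    ⟨r, le_rfl, fun s h h' => absurd h h'.not_ge⟩
  obtain ⟨har, hbusy⟩ := Nat.find_spec hex
  have hmin : ∀ a' < Nat.find hex, ¬ _ := fun a' => Nat.find_min hex
  generalize Nat.find hex = a at har hbusy hmin
  refine ⟨a, har, hbusy, ?_⟩
  rcases a with _ | a
  · exact ⟨∅, Finset.empty_subset _, by simp, fun j _ k s _ _ h => absurd h (Nat.not_lt_zero _)⟩
  have hnot : ¬ FullyBusy m σ i a := by
    intro h
    refine hmin a a.lt_succ_self ⟨a.le_succ.trans har, fun s h₁ h₂ => ?_⟩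
    rcases h₁.eq_or_lt with rfl | h₁
    · exact h
    · exact hbusy s h₁ h₂
  -- Slot `a`, just before the window, is not fully busy, so fewer than `m` higher-priority jobs run
  -- in it. A carried-in job is available there and must be one of them, as otherwise greediness
  -- would fill the slot with `m` jobs of higher priority than `i`.
  refine ⟨((σ a).filter fun p => p.1 < i).image Prod.fst, ?_, ?_, ?_⟩
  · intro j hj
    obtain ⟨p, hp, rfl⟩ := Finset.mem_image.1 hj
    exact Finset.mem_Iio.2 (Finset.mem_filter.1 hp).2
  · refine Nat.le_sub_one_of_lt (Finset.card_image_le.trans_lt ?_)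
    refine lt_of_le_of_ne ((Finset.card_filter_le _ _).trans (hσ.card_le a)) fun h => hnot ?_
    have hc : ((σ a).filter fun p => p.1 < i) = σ a :=
      Finset.eq_of_subset_of_card_le (Finset.filter_subset _ _) (h ▸ hσ.card_le a)
    exact ⟨hc ▸ h, fun p hp => (Finset.filter_eq_self.1 hc) p hp⟩
  · intro j hj k s has hks hr
    have hav := hσ.available_of_mem_later hks (a.le_succ.trans has) (Nat.le_of_lt_succ hr)
    have hmem : (j, k) ∈ σ a := by
      by_contra hn
      obtain ⟨h₁, h₂⟩ := hσ.greedy a j k hav hn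
      exact hnot ⟨h₁, fun p hp => (h₂ p hp).trans_lt hj⟩
    exact Finset.mem_image.2 ⟨(j, k), Finset.mem_filter.2 ⟨hmem, hj⟩, rfl⟩

/-- If no two jobs of one task execute in the same slot, the work of the tasks of higher priority
in a set of fully busy slots adds up to `m` per slot. -/
theorem card_mul_le_sum {i : Fin n} {Q : Finset ℕ} (hQ : ∀ s ∈ Q, FullyBusy m σ i s)
    (hinj : ∀ s ∈ Q, ∀ j k l, (j, k) ∈ σ s → (j, l) ∈ σ s → k = l)
    (B : Fin n → Finset ℕ) (hB : ∀ s ∈ Q, ∀ j k, (j, k) ∈ σ s → s ∈ B j) :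
    Q.card * m ≤ ∑ j ∈ Finset.Iio i, (Q ∩ B j).card := by
  classical
  have h : ∀ s ∈ Q, m ≤ ((Finset.Iio i).filter fun j => s ∈ B j).card := by
    intro s hs
    rw [← (hQ s hs).1]
    refine Finset.card_le_card_of_injOn Prod.fst ?_ ?_
    · intro p hp
      exact Finset.mem_filter.2 ⟨Finset.mem_Iio.2 ((hQ s hs).2 p hp), hB s hs p.1 p.2 hp⟩
    · rintro ⟨j, k⟩ hp ⟨j', l⟩ hq (rfl : j = j')
      rw [hinj s hs j k l hp hq]
  calc Q.card * m = ∑ _s ∈ Q, m := by simp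
    _ ≤ ∑ s ∈ Q, ((Finset.Iio i).filter fun j => s ∈ B j).card := Finset.sum_le_sum h
    _ = ∑ j ∈ Finset.Iio i, (Q.filter fun s => s ∈ B j).card :=
      Finset.sum_card_bipartiteAbove_eq_sum_card_bipartiteBelow fun s j => s ∈ B j
    _ = _ := by simp only [Finset.filter_mem_eq_inter]

/-- The total work of the tasks of higher priority than `i` in `x + 1 - C` fully busy slots of a
window of length `x` that starts with at most `m - 1` tasks with carry-in. -/
theorem IsMSM.card_mul_le_totalInt (hσ : IsMSM m J σ) {i : Fin n} {v a x : ℕ} (hv : 1 ≤ v)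
    (hlevel : critLevel J σ (a + x) ≤ v)
    (hsched : ∀ j < i, responseTime τ m j (min v (τ j).L) ≤ ((τ j).D : ℕ∞))
    (hhp : ∀ j < i, CompletesWithin J σ (min v (τ j).L) j
      (responseTime τ m j (min v (τ j).L)))
    {S : Finset (Fin n)} (hS : S ⊆ Finset.Iio i) (hcard : S.card ≤ m - 1)
    (hcarry : ∀ j < i, ∀ k s, a ≤ s → (j, k) ∈ σ s → J.release j k < a → j ∈ S)
    {Q : Finset ℕ} (hQ : ∀ s ∈ Q, FullyBusy m σ i s) (hQw : Q ⊆ Finset.Ico a (a + x))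
    (hQc : Q.card = x + 1 - (τ i).C v) :
    Q.card * m ≤ totalInt τ m i x v := by
  have hE : ∀ j < i, ∀ k s, s < a + x → (j, k) ∈ σ s →
      J.release j k ≤ s ∧ s < J.release j k + (τ j).D := fun j hj k s hs h =>
    ⟨(hσ.available s j k h).2.1,
      hσ.lt_release_add (hhp j hj) (hsched j hj) ((hσ.critLevel_mono hs.le).trans hlevel) h⟩
  have hr : ∀ j, ∀ k l s s', s < a + x → s' < a + x → (j, k) ∈ σ s → (j, l) ∈ σ s' → k < l →
      J.release j k + (τ j).T ≤ J.release j l := fun j k l s s' _ _ _ h hkl =>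
    J.release_add_le j hkl (hσ.available s' j l h).1
  have hC : ∀ j k, (busySlots (fun _ s => (j, k) ∈ σ s) 0 (a + x)).card ≤ (τ j).C v := by
    intro j k
    by_cases hk : (k : ℕ∞) < J.count j
    · refine le_trans (Finset.card_le_card fun s hs => ?_)
        ((hσ.critLevel_le_iff hv).1 hlevel j k hk).2
      obtain ⟨h, _, h'⟩ := mem_busySlots.1 hs
      exact Finset.mem_filter.2 ⟨Finset.mem_range.2 h.2, h'⟩
    · rw [Finset.card_eq_zero.2 (Finset.eq_empty_of_forall_notMem fun s hs => ?_)]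
      · exact Nat.zero_le _
      · obtain ⟨-, _, h⟩ := mem_busySlots.1 hs
        exact hk (hσ.available s j k h).1
  have hCD : ∀ j < i, (τ j).C v ≤ (τ j).D := fun j hj =>
    wcet_le_deadline_of_responseTime_le (hsched j hj)
  have hwin : ∀ s ∈ Q, a ≤ s ∧ s < a + x := fun s hs => Finset.mem_Ico.1 (hQw hs)
  refine (card_mul_le_sum hQ ?_ (fun j => busySlots (fun k s => (j, k) ∈ σ s) a (a + x)) ?_).trans
    (le_totalInt i x v hS hcard ?_ ?_)
  -- Jobs of one task execute within `D ≤ T` of releases at least `T` apart, so never in the same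
  -- slot.
  · intro s hs j k l hk hl
    have hj := (hQ s hs).2 _ hk
    have hsx := (hwin s hs).2
    have h₁ := hE j hj k s hsx hk
    have h₂ := hE j hj l s hsx hl
    have hDT := (τ j).deadline_le_period
    rcases lt_trichotomy k l with h | h | h
    · have := hr j k l s s hsx hsx hk hl h
      omega
    · exact h
    · have := hr j l k s s hsx hsx hl hk h
      omega
  · exact fun s hs j k h => mem_busySlots.2 ⟨hwin s hs, k, h⟩
  · intro j hj hjS
    refine le_min ((Finset.card_le_card Finset.inter_subset_right).trans ?_)
      (hQc ▸ Finset.card_le_card Finset.inter_subset_left)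
    have := card_busySlots_le_workloadNC (τ j).period_pos (hE j hj) (τ j).deadline_le_period
      ((hCD j hj).trans (τ j).deadline_le_period) (hr j) (hC j) a
      (fun k s h _ hks => not_lt.1 fun hlt => hjS (hcarry j hj k s h hks hlt))
    rwa [Nat.add_sub_cancel_left] at this
  · intro j hj
    have hj := Finset.mem_Iio.1 (hS hj)
    refine le_min ((Finset.card_le_card Finset.inter_subset_right).trans ?_)
      (hQc ▸ Finset.card_le_card Finset.inter_subset_left)
    have := card_busySlots_le_workloadCI (τ j).period_pos (hE j hj) (τ j).deadline_le_period
      (hCD j hj) (hr j) (hC j) a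
    rwa [Nat.add_sub_cancel_left] at this

/-- While a job is pending and the only pending one of its task, it executes in every slot that
is not fully busy with jobs of higher priority. -/
theorem IsMSM.fullyBusy_of_notMem (hσ : IsMSM m J σ) {i : Fin n} {k s : ℕ}
    (hav : Available J σ i k s) (hn : (i, k) ∉ σ s) (honly : ∀ l, (i, l) ∈ σ s → l = k) :
    FullyBusy m σ i s := by
  obtain ⟨h₁, h₂⟩ := hσ.greedy s i k hav hn
  refine ⟨h₁, ?_⟩
  rintro ⟨j, l⟩ hp
  refine lt_of_le_of_ne (h₂ _ hp) ?_
  rintro rfl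
  exact hn (honly l hp ▸ hp)

end MCTask

/-! ### Induction over the jobs of the analysed task. -/

open MCTask in
theorem mainTheorem1 {n : ℕ} (τ : Fin n → MCTask) (m : ℕ) (hm : 1 ≤ m)
    (J : MCTask.JobSequence τ) (σ : MCTask.Schedule n) (hσ : MCTask.IsMSM m J σ)
    (i : Fin n) (ℓ : ℕ) (hℓ : 1 ≤ ℓ) (hℓi : ℓ ≤ (τ i).L)
    (hsched : ∀ j ≤ i, MCTask.responseTime τ m j (min ℓ (τ j).L) ≤ ((τ j).D : ℕ∞))
    (hhp : ∀ j < i, MCTask.CompletesWithin J σ (min ℓ (τ j).L) j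
      (MCTask.responseTime τ m j (min ℓ (τ j).L))) :
    MCTask.CompletesWithin J σ ℓ i (MCTask.responseTime τ m i ℓ) := by
  classical
  have hRD := hsched i le_rfl
  rw [min_eq_left hℓi] at hRD
  obtain ⟨x, hfix, hx⟩ := exists_eq_responseTime hRD
  rw [hx, Nat.cast_le] at hRD
  have hxT := hRD.trans (τ i).deadline_le_period
  rw [hx]
  intro k
  induction k using Nat.strong_induction_on with
  | _ k ih =>
    intro t hk ht hlevel
    have ht' : J.release i k + x ≤ t := by exact_mod_cast ht
    by_contra hinc
    have hlevel' : ∀ s ≤ t, critLevel J σ s ≤ ℓ := fun s hs => (hσ.critLevel_mono hs).trans hlevel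
    -- Since `x ≤ T`, earlier jobs are finished by induction and later ones not yet released.
    have honly : ∀ s, J.release i k ≤ s → s < J.release i k + x → ∀ l, (i, l) ∈ σ s → l = k := by
      intro s hs hsx l hl
      have hav := hσ.available s i l hl
      rcases lt_trichotomy l k with h | h | h
      · have h₁ := J.release_add_le i h hk
        refine absurd (ih l h s hav.1 ?_ (hlevel' s (by omega))) hav.2.2.1
        exact_mod_cast (show J.release i l + x ≤ s by omega)
      · exact h
      · have h₁ := J.release_add_le i h hav.1
        have h₂ := hav.2.1
        omega
    obtain ⟨a, har, hbusy, S, hS, hcard, hcarry⟩ := hσ.exists_busy_start i (J.release i k)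
    have hfull : ∀ s ∈ (Finset.Ico a (a + x)).filter (fun s => (i, k) ∉ σ s),
        FullyBusy m σ i s := by
      intro s hs
      obtain ⟨hsw, hn⟩ := Finset.mem_filter.1 hs
      rw [Finset.mem_Ico] at hsw
      rcases Nat.lt_or_ge s (J.release i k) with h | h
      · exact hbusy s hsw.1 h
      · exact hσ.fullyBusy_of_notMem
          ⟨hk, h, fun hc => hinc (hc.mono (by omega)), (hlevel' s (by omega)).trans hℓi⟩ hn
          (honly s h (by omega))
    have hserv : service σ i k t < (τ i).C ℓ := by
      have h₁ := ((hσ.critLevel_le_iff hℓ).1 hlevel i k hk).1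
      have h₂ : service σ i k t < J.cost i k := not_le.1 hinc
      omega
    have hexec : ((Finset.Ico a (a + x)).filter fun s => (i, k) ∈ σ s).card ≤ service σ i k t := by
      refine Finset.card_le_card fun s hs => ?_
      simp only [Finset.mem_filter, Finset.mem_Ico, Finset.mem_range] at hs ⊢
      exact ⟨by omega, hs.2⟩
    have hsplit := Finset.card_filter_add_card_filter_not
      (s := Finset.Ico a (a + x)) (fun s => (i, k) ∈ σ s)
    rw [Nat.card_Ico] at hsplit
    -- Trimming to exactly this many slots makes the cap in `intNC` and `intCI` equal to `Q.card`.
    obtain ⟨Q, hQ, hQc⟩ := Finset.exists_subset_card_eq (n := x + 1 - (τ i).C ℓ)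
      (s := (Finset.Ico a (a + x)).filter fun s => (i, k) ∉ σ s) (by omega)
    have hwork := hσ.card_mul_le_totalInt hℓ (hlevel' (a + x) (by omega))
      (fun j hj => hsched j hj.le) hhp hS hcard hcarry (fun s hs => hfull s (hQ hs))
      (hQ.trans (Finset.filter_subset _ _)) hQc
    have := (Nat.le_div_iff_mul_le hm).2 hwork
    omega
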